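/- Arbitrary-connections sensor networks with an i.i.d. prior and heterogeneous sensors. Let $\mathcal V,\mathcal X,\mathcal Y$ be finite sets, let $P_V$ be a probability mass function on $\mathcal V$, and let $D\in[0,1]$. There are finitely many sensor classes $l$; a sensor of class $l$ has a range $c_l$, a sensing function $\Psi_l:\mathcal V^{c_l}\to\mathcal X$ and a noise model given by a conditional p.m.f. $P^{l}_{Y|X}$ from $\mathcal X$ to $\mathcal Y$. A network of $n$ sensors over $k$ target positions connects each sensor $\ell$, of class $l(\ell)$, to an ordered list of $c_{l(\ell)}$ positions (repetitions allowed). For a target vector $v\in\mathcal V^k$, sensor $\ell$ has ideal output $x_\ell(v)=\Psi_{l(\ell)}(\text{entries of }v\text{ at its positions})$, and the observed vector $y\in\mathcal Y^n$ has probability $\prod_\ell P^{l(\ell)}_{Y|X}(y_\ell|x_\ell(v))$. The entries of $v$ are i.i.d. with law $P_V$, and $v$ is detected from $y$ by a maximum a posteriori (MAP) detector $g$, that is, $g(y)$ maximizes the product of the prior and the likelihood over $\mathcal V^k$, with ties broken arbitrarily. An error occurs if $\frac1k d_H(v,g(y))\ge D$, where $d_H$ is the Hamming distance. For every $n$ let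 the classes of the $n$ sensors be prescribed so that, for each $l$, the fraction of sensors of class $l$ tends to $\alpha_l$ as $n\to\infty$. A rate $R>0$ is achievable if there is a sequence of networks of $n$ sensors of the prescribed classes over $\lceil nR\rceil$ positions whose error probability (averaged over $v$ and $y$) tends to $0$ as $n\to\infty$ for every choice of MAP detectors. The sensing capacity $C(D)\in[0,\infty]$ is the supremum of the $R\ge 0$ such that all rates in $(0,R)$ are achievable. For p.m.f.s $\gamma$ on $\mathcal V$ and $\lambda$ on $\mathcal V^2$ let $P^{\gamma,l}(x)=\sum_{u\in\mathcal V^{c_l}:\,\Psi_l(u)=x}\prod_t\gamma_{u_t}$ and $P^{\lambda,l}(x,x')=\sum_{u,u'\in\mathcal V^{c_l}:\,\Psi_l(u)=x,\,\Psi_l(u')=x'}\prod_t\lambda_{u_tu'_t}$, and put $$P^{\gamma,l}_{X_iY}(x,y)=P^{\gamma,l}(x)\,P^l_{Y|X}(y|x),\qquad Q^{\lambda,l}_{X_iY}(x,y)=\sum_{a\in\mathcal X}P^{\lambda,l}(x,a)\,P^l_{Y|X}(y|a).$$ Then $$C(D)\ \ge\ C_{LB}(D)=\min_{\lambda}\ \frac{\sum_l\alpha_l\,D\big(P^{\gamma_i,l}_{X_iY}\,\big\|\,Q^{\lambda,l}_{X_iY}\big)}{H(\lambda)-H(\gamma_j)-D(\gamma_j\|P_V)},$$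 where $\gamma_i=P_V$, $\gamma_j$ is the second marginal of $\lambda$, $\gamma_{jb}=\sum_a\lambda_{ab}$, $H$ is the entropy and $D(\cdot\|\cdot)\in[0,\infty]$ the Kullback-Leibler distance (base-2 logarithms), and the minimum (understood as an infimum, $+\infty$ if there is no such $\lambda$) is over the p.m.f.s $\lambda$ on $\mathcal V^2$ with $\sum_{a\ne b}\lambda_{ab}\ge D$, $\sum_b\lambda_{ab}=\gamma_{ia}$ for all $a$, and nonnegative denominator. Conventions: $0\cdot\infty=0$ in the numerator; if the denominator is $0$, the ratio is $+\infty$ for a positive numerator and $0$ for a zero numerator. -/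

import Mathlib

open Filter Topology
open scoped NNReal ENNReal

noncomputable section

namespace SensorNetwork

/-! ## Entropy and divergence of probability mass functions on finite sets, in bits -/

/-- Shannon entropy (base 2) of a p.m.f. on a finite set; `0 log 0 = 0`. -/
def entropy {A : Type*} [Fintype A] (p : A → ℝ) : ℝ :=
  -∑ a, p a * Real.logb 2 (p a)

open Classical in
/-- Kullback-Leibler distance (base 2) of two p.m.f.s on a finite set. It is `+∞` when `p` is not
absolutely continuous with respect to `q`. -/
def klDist {A : Type*} [Fintype A] (p q : A → ℝ) : ℝ≥0∞ :=
  if ∀ a, q a = 0 → p a = 0 then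
    ENNReal.ofReal (∑ a, p a * Real.logb 2 (p a / q a))
  else ⊤

/-! ## Sensors and sensor networks -/

/-- A class of sensors: its range `c`, its sensing function `Ψ : V^c → X` and its noise model, the
conditional p.m.f. `P_{Y|X}` (written `noise x y`). -/
structure SensorClass (V X Y : Type*) [Fintype Y] where
  range : ℕ
  sense : (Fin range → V) → X
  noise : X → Y → ℝ
  noise_mem : ∀ x, noise x ∈ stdSimplex ℝ Y

section Network

variable {V X Y L : Type*} [Fintype V] [DecidableEq V] [Fintype X] [DecidableEq X] [Fintype Y]

/-- A network of `n` sensors over `k` target positions, sensor `ℓ` being of class `cls ℓ`: each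
sensor is connected to as many positions (repetitions allowed) as its range says. -/
def Network (S : L → SensorClass V X Y) {n : ℕ} (cls : Fin n → L) (k : ℕ) : Type :=
  (ℓ : Fin n) → Fin (S (cls ℓ)).range → Fin k

/-- The noiseless output vector (codeword) of the network for the target vector `v`. -/
def idealOutput (S : L → SensorClass V X Y) {n k : ℕ} {cls : Fin n → L}
    (s : Network S cls k) (v : Fin k → V) : Fin n → X :=
  fun ℓ => (S (cls ℓ)).sense (fun t => v (s ℓ t))

/-- The probability of the noisy output vector `y` given that `v` occurred: the noise is
independent across sensors. -/
def likelihood (S : L → SensorClass V X Y) {n k : ℕ} {cls : Fin n → L}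
    (s : Network S cls k) (v : Fin k → V) (y : Fin n → Y) : ℝ :=
  ∏ ℓ, (S (cls ℓ)).noise (idealOutput S s v ℓ) (y ℓ)

/-- The probability of the target vector `v` when its entries are i.i.d. with p.m.f. `P`. -/
def priorProb (P : V → ℝ) {k : ℕ} (v : Fin k → V) : ℝ :=
  ∏ t, P (v t)

/-- `g` is a maximum a posteriori detector (ties are broken in any way). -/
def IsMAP (S : L → SensorClass V X Y) (P : V → ℝ) {n k : ℕ} {cls : Fin n → L}
    (s : Network S cls k) (g : (Fin n → Y) → (Fin k → V)) : Prop :=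
  ∀ y v, priorProb P v * likelihood S s v y ≤ priorProb P (g y) * likelihood S s (g y) y

/-- MAP detectors exist. -/
theorem exists_isMAP [Nonempty V] (S : L → SensorClass V X Y) (P : V → ℝ) {n k : ℕ}
    {cls : Fin n → L} (s : Network S cls k) :
    ∃ g : (Fin n → Y) → (Fin k → V), IsMAP S P s g := by
  have h : ∀ y : Fin n → Y, ∃ w : Fin k → V, ∀ v,
      priorProb P v * likelihood S s v y ≤ priorProb P w * likelihood S s w y :=
    fun y => Finite.exists_max (fun v => priorProb P v * likelihood S s v y)
  choose g hg using h
  exact ⟨g, hg⟩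

open Classical in
/-- The expected probability of error of the network `s` with the detector `g` at distortion `D`:
an error occurs when the true target vector `v` and the detected one differ in a fraction of the
positions that is not less than `D`. -/
def errorProb (S : L → SensorClass V X Y) (P : V → ℝ) (D : ℝ) {n k : ℕ} {cls : Fin n → L}
    (s : Network S cls k) (g : (Fin n → Y) → (Fin k → V)) : ℝ :=
  ∑ v : Fin k → V, priorProb P v *
    ∑ y : Fin n → Y, likelihood S s v y *
      (if (hammingDist v (g y) : ℝ) / k < D then 0 else 1)

/-- The rate `R` is achievable: there are networks of `n` sensors, of the prescribed classes
`cls n`, over `⌈n R⌉` target positions, whose expected probability of error under MAP detection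
tends to `0` as `n → ∞`. -/
def Achievable (S : L → SensorClass V X Y) (P : V → ℝ) (D : ℝ) (cls : (n : ℕ) → Fin n → L)
    (R : ℝ≥0) : Prop :=
  ∃ s : (n : ℕ) → Network S (cls n) ⌈(n : ℝ) * R⌉₊,
    ∀ g : (n : ℕ) → (Fin n → Y) → (Fin ⌈(n : ℝ) * R⌉₊ → V),
      (∀ n, IsMAP S P (s n) (g n)) →
        Tendsto (fun n => errorProb S P D (s n) (g n)) atTop (𝓝 0)

/-- The sensing capacity: the largest `R` such that all positive rates below `R` are achievable. -/
def sensingCapacity (S : L → SensorClass V X Y) (P : V → ℝ) (D : ℝ)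
    (cls : (n : ℕ) → Fin n → L) : ℝ≥0∞ :=
  ⨆ (R : ℝ≥0) (_ : ∀ R' : ℝ≥0, 0 < R' → R' < R → Achievable S P D cls R'), (R : ℝ≥0∞)

/-- Class `l` is used with (asymptotic) relative frequency `α l`. -/
def HasFrequencies [DecidableEq L] (cls : (n : ℕ) → Fin n → L) (α : L → ℝ≥0) : Prop :=
  ∀ l, Tendsto (fun n : ℕ => ((Finset.univ.filter fun ℓ => cls n ℓ = l).card : ℝ) / n)
    atTop (𝓝 (α l : ℝ))

/-! ## The single-sensor distributions and the lower bound -/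

/-- `P^γ(x)`: the p.m.f. of the ideal output of a sensor whose connections hit i.i.d. symbols with
p.m.f. `γ`, i.e. of a randomly connected sensor when the target vector has type `γ`. -/
def outputDist (C : SensorClass V X Y) (γ : V → ℝ) (x : X) : ℝ :=
  ∑ u : Fin C.range → V, if C.sense u = x then ∏ t, γ (u t) else 0

/-- `P^λ(x_i, x_j)`: the joint p.m.f. of the ideal outputs of one randomly connected sensor for two
target vectors of joint type `lam`. -/
def jointOutputDist (C : SensorClass V X Y) (lam : V × V → ℝ) (x x' : X) : ℝ :=
  ∑ w : Fin C.range → V × V,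
    if C.sense (fun t => (w t).1) = x ∧ C.sense (fun t => (w t).2) = x' then
      ∏ t, lam (w t) else 0

/-- `P_{X_i Y}^γ(x, y) = P^γ(x) P_{Y|X}(y|x)`. -/
def distP (C : SensorClass V X Y) (γ : V → ℝ) : X × Y → ℝ :=
  fun z => outputDist C γ z.1 * C.noise z.1 z.2

/-- `Q_{X_i Y}^λ(x, y) = ∑ a, P^λ(x, a) P_{Y|X}(y|a)`. -/
def distQ (C : SensorClass V X Y) (lam : V × V → ℝ) : X × Y → ℝ :=
  fun z => ∑ a, jointOutputDist C lam z.1 a * C.noise a z.2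

/-- The second marginal `γ_j` of `lam`. -/
def sndMarginal (lam : V × V → ℝ) : V → ℝ := fun b => ∑ a, lam (a, b)

/-- The feasible set: p.m.f.s on `V × V` with first marginal `P` and off-diagonal mass at
least `D`. -/
def feasible (P : V → ℝ) (D : ℝ) : Set (V × V → ℝ) :=
  {lam | lam ∈ stdSimplex ℝ (V × V) ∧ (∀ a, ∑ b, lam (a, b) = P a) ∧
    D ≤ ∑ a, ∑ b, if a ≠ b then lam (a, b) else 0}

/-- The numerator `∑ l, α l * D(P^{γ_i, l} ‖ Q^{λ, l})` with `γ_i = P`. -/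
def numerator [Fintype L] (S : L → SensorClass V X Y) (α : L → ℝ≥0) (P : V → ℝ)
    (lam : V × V → ℝ) : ℝ≥0∞ :=
  ∑ l, (α l : ℝ≥0∞) * klDist (distP (S l) P) (distQ (S l) lam)

/-- The denominator `H(λ) - H(γ_j) - D(γ_j ‖ P)`; it may be negative, or `-∞`. -/
def denominator (P : V → ℝ) (lam : V × V → ℝ) : EReal :=
  ((entropy lam - entropy (sndMarginal lam) : ℝ) : EReal)
    - (klDist (sndMarginal lam) P : EReal)

/-- The lower bound `C_LB(D)`: the least value of the ratio over the feasible `lam` with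
nonnegative denominator. In `ℝ≥0∞` one has `a / 0 = ∞` for `a > 0` and `0 / 0 = 0`. -/
def lowerBound [Fintype L] (S : L → SensorClass V X Y) (α : L → ℝ≥0) (P : V → ℝ) (D : ℝ) :
    ℝ≥0∞ :=
  ⨅ (lam : V × V → ℝ) (_ : lam ∈ feasible P D) (_ : 0 ≤ denominator P lam),
    numerator S α P lam / (denominator P lam).toENNReal

end Network

end SensorNetwork

end

set_option linter.unusedSectionVars false

namespace SensorNetwork

/-! ### Averages over uniformly random networks -/

section Averages

variable {V X Y L : Type*} [Fintype V] [DecidableEq V] [Fintype X] [DecidableEq X] [Fintype Y]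

/-! The argument is random coding: every sensor picks its connections uniformly and independently,
and some network does no worse than the average. An error at distortion `D` forces a confusion: a
vector `v'` whose joint type with the true `v` has off-diagonal mass at least `D` and whose
posterior weight is at least that of `v`. This event does not depend on the MAP detector.

Joint types lie in a compact simplex, so instead of counting types it suffices to give each `lam` a
neighbourhood on which the average confusion probability vanishes. If the first marginal of `lam` is
not `P`, the type of `v` is atypical and a Chernoff bound applies. Otherwise `lam` is feasible, and
the confusion event is split by a threshold `n θ` on the statistic `∑ log (p / q)` of codeword and
observation, with `p`, `q` the laws `distP` and `distQ`. Under the true `v` the pairs follow `p`, so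
falling below the threshold is exponentially unlikely for `θ < ∑ α D(p‖q)`. Above it, the posterior
comparison replaces `v` by `v'`; then the pairs follow `q`, which costs `exp (-n θ)`, while the
pairs `(v, v')` weighted by the prior of `v'` contribute about `exp (-k ∑ lam log (lam / P))`, whose
exponent is `k` times the denominator in nats. A suitable `θ` exists when `R` is below the ratio.

Zeros of `p`, `q`, `P` and infinite divergences are handled by adding a small `η` to all masses. The
lemmas that carry this are `sum_network_likelihood_mul_prod`, `confusionProb_le`,
`sum_priorProb_le_exp`, `exists_regDiv_gt` and `sum_divergence_pos_of_lt_lowerBound`. -/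

noncomputable instance (S : L → SensorClass V X Y) {n : ℕ} (cls : Fin n → L) (k : ℕ) :
    Fintype (Network S cls k) :=
  inferInstanceAs (Fintype ((ℓ : Fin n) → Fin (S (cls ℓ)).range → Fin k))

/-- The joint empirical distribution of two target vectors. -/
noncomputable def jointType {k : ℕ} (v v' : Fin k → V) : V × V → ℝ :=
  fun ab => ((Finset.univ.filter fun t => (v t, v' t) = ab).card : ℝ) / k

/-- Group the connection maps by the symbols they read: the maps reading `u` number the product of
the fibre sizes of `w`. Hence a uniformly connected sensor sees i.i.d. symbols distributed as the
type of `w`. -/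
theorem sum_comp_eq_sum_mul_prod_card {A : Type*} [Fintype A] [DecidableEq A] {c k : ℕ}
    (w : Fin k → A) (φ : (Fin c → A) → ℝ) :
    ∑ σ : Fin c → Fin k, φ (fun t => w (σ t)) =
      ∑ u : Fin c → A, (∏ t, ((Finset.univ.filter fun j => w j = u t).card : ℝ)) * φ u := by
  have h : ∀ u : Fin c → A, (∏ t, ((Finset.univ.filter fun j => w j = u t).card : ℝ)) =
      ∑ σ : Fin c → Fin k, if (fun t => w (σ t)) = u then 1 else 0 := by
    intro u
    rw [← Nat.cast_prod, ← Fintype.card_piFinset, Finset.sum_boole]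
    congr 2
    ext σ
    simp [funext_iff]
  simp_rw [h, Finset.sum_mul]
  rw [Finset.sum_comm]
  simp

theorem sum_distQ_mul (C : SensorClass V X Y) (lam : V × V → ℝ) (g : X × Y → ℝ) :
    ∑ z, distQ C lam z * g z = ∑ w : Fin C.range → V × V, (∏ t, lam (w t)) *
      ∑ y, C.noise (C.sense fun t => (w t).2) y * g (C.sense fun t => (w t).1, y) := by
  have h : ∀ w : Fin C.range → V × V,
      (∏ t, lam (w t)) *
        ∑ y, C.noise (C.sense fun t => (w t).2) y * g (C.sense fun t => (w t).1, y) =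
      ∑ z : X × Y, ∑ a, (if C.sense (fun t => (w t).1) = z.1 ∧ C.sense (fun t => (w t).2) = a then
        ∏ t, lam (w t) else 0) * C.noise a z.2 * g z := by
    intro w
    rw [Fintype.sum_prod_type, Finset.sum_comm, Finset.mul_sum]
    refine Finset.sum_congr rfl fun y _ => ?_
    simp [ite_and, mul_assoc]
  simp_rw [h]
  rw [Finset.sum_comm]
  refine Finset.sum_congr rfl fun z _ => ?_
  rw [Finset.sum_comm]
  simp_rw [distQ, jointOutputDist, Finset.sum_mul]

theorem distQ_nonneg (C : SensorClass V X Y) {lam : V × V → ℝ} (h : ∀ z, 0 ≤ lam z) (z : X × Y) :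
    0 ≤ distQ C lam z := by
  refine Finset.sum_nonneg fun a _ => mul_nonneg (Finset.sum_nonneg fun w _ => ?_)
    ((C.noise_mem a).1 _)
  split_ifs
  · exact Finset.prod_nonneg fun t _ => h _
  · exact le_rfl

theorem sum_distQ (C : SensorClass V X Y) {lam : V × V → ℝ} (h : lam ∈ stdSimplex ℝ (V × V)) :
    ∑ z, distQ C lam z = 1 := by
  have := sum_distQ_mul C lam (fun _ => 1)
  simp only [mul_one, (C.noise_mem _).2] at this
  rw [this, ← Fintype.piFinset_univ,
    ← Finset.prod_univ_sum (fun _ => Finset.univ) fun (_ : Fin C.range) z => lam z]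
  simp [h.2]

theorem continuous_distQ (C : SensorClass V X Y) (z : X × Y) :
    Continuous fun lam : V × V → ℝ => distQ C lam z := by
  unfold distQ jointOutputDist
  refine continuous_finsetSum _ fun a _ => Continuous.mul (continuous_finsetSum _ fun w _ => ?_)
    continuous_const
  split_ifs <;> fun_prop

theorem continuous_sum_distQ_mul (C : SensorClass V X Y) (g : X × Y → ℝ) :
    Continuous fun lam : V × V → ℝ => ∑ z, distQ C lam z * g z :=
  continuous_finsetSum _ fun z _ => (continuous_distQ C z).mul continuous_const

/-- The diagonal distribution with the first marginal of `lam`. -/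
def diagFst (lam : V × V → ℝ) : V × V → ℝ :=
  fun ab => if ab.1 = ab.2 then ∑ b, lam (ab.1, b) else 0

theorem continuous_diagFst : Continuous (diagFst : (V × V → ℝ) → (V × V → ℝ)) := by
  refine continuous_pi fun ab => ?_
  unfold diagFst
  split_ifs <;> fun_prop

theorem diagFst_jointType {k : ℕ} (v v' : Fin k → V) :
    diagFst (jointType v v') = jointType v v := by
  ext ⟨a, b⟩
  simp only [diagFst, jointType, Prod.mk.injEq]
  split_ifs with h
  · subst h
    rw [← Finset.sum_div, ← Nat.cast_sum]
    congr 2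
    rw [Finset.card_eq_sum_card_fiberwise (f := v') (t := Finset.univ) (by simp)]
    simp [Finset.filter_filter]
  · rw [Finset.filter_false_of_mem]
    · simp
    · rintro t - ⟨rfl, rfl⟩
      exact h rfl

/-- The case `v' = v`: the two codewords coincide, so `distQ` collapses to `distP`. One moment
computation then serves both the true vector and its competitors. -/
theorem distQ_diagFst (C : SensorClass V X Y) {P : V → ℝ} {lam : V × V → ℝ}
    (h : ∀ a, ∑ b, lam (a, b) = P a) : distQ C (diagFst lam) = distP C P := by
  have h1 : ∀ x a, jointOutputDist C (diagFst lam) x a =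
      if x = a then outputDist C P x else 0 := by
    intro x a
    unfold jointOutputDist outputDist
    -- Only words with both coordinates equal carry mass, so the sum reduces to the diagonal.
    have : ∀ w : Fin C.range → V × V, w ∉ Set.range (fun u : Fin C.range → V => fun t => (u t, u t)) →
        ∏ t, diagFst lam (w t) = 0 := by
      intro w hw
      obtain ⟨t, ht⟩ : ∃ t, (w t).1 ≠ (w t).2 := by
        by_contra! hc
        exact hw ⟨fun t => (w t).1, funext fun t => Prod.ext rfl (hc t)⟩
      exact Finset.prod_eq_zero (Finset.mem_univ t) (by simp [diagFst, ht])
    rw [← Fintype.sum_of_injective (fun u : Fin C.range → V => fun t => (u t, u t))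
      (fun u u' huu => funext fun t => congrArg Prod.fst (congrFun huu t))
      (fun u => if C.sense u = x ∧ C.sense u = a then ∏ t, P (u t) else 0) _
      (fun w hw => by rw [this w hw, ite_self]) (fun u => by simp [diagFst, h])]
    split_ifs with hxa
    · simp [hxa]
    · refine Finset.sum_eq_zero fun u _ => if_neg ?_
      rintro ⟨rfl, rfl⟩
      exact hxa rfl
  ext z
  simp [distQ, distP, h1]

/-- Connections and noise are independent across sensors, so the average factors exactly. Each
factor depends on `v`, `v'` only through their joint type. -/
theorem sum_network_likelihood_mul_prod (S : L → SensorClass V X Y) {n k : ℕ} (hk : k ≠ 0)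
    (cls : Fin n → L) (v v' : Fin k → V) (g : L → X × Y → ℝ) :
    ∑ s : Network S cls k, ∑ y, likelihood S s v' y *
        ∏ ℓ, g (cls ℓ) (idealOutput S s v ℓ, y ℓ) =
      Fintype.card (Network S cls k) *
        ∏ ℓ, ∑ z, distQ (S (cls ℓ)) (jointType v v') z * g (cls ℓ) z := by
  have hcard : (Fintype.card (Network S cls k) : ℝ) = ∏ ℓ, (k : ℝ) ^ (S (cls ℓ)).range := by
    have : Fintype.card (Network S cls k) =
      Fintype.card ((ℓ : Fin n) → Fin (S (cls ℓ)).range → Fin k) := rfl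
    rw [this]
    simp [Fintype.card_pi]
  have hone : ∀ ℓ, ∑ σ : Fin (S (cls ℓ)).range → Fin k, ∑ y,
      (S (cls ℓ)).noise ((S (cls ℓ)).sense fun t => v' (σ t)) y *
        g (cls ℓ) ((S (cls ℓ)).sense fun t => v (σ t), y) =
      (k : ℝ) ^ (S (cls ℓ)).range *
        ∑ z, distQ (S (cls ℓ)) (jointType v v') z * g (cls ℓ) z := by
    intro ℓ
    rw [sum_distQ_mul, Finset.mul_sum, sum_comp_eq_sum_mul_prod_card (fun j => (v j, v' j))
      (fun w => ∑ y, (S (cls ℓ)).noise ((S (cls ℓ)).sense fun t => (w t).2) y *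
        g (cls ℓ) ((S (cls ℓ)).sense fun t => (w t).1, y))]
    refine Finset.sum_congr rfl fun u _ => ?_
    rw [← mul_assoc]
    congr 1
    simp only [jointType, Finset.prod_div_distrib, Finset.prod_const, Finset.card_univ,
      Fintype.card_fin]
    field_simp
  rw [hcard, ← Finset.prod_mul_distrib, ← Finset.prod_congr rfl fun ℓ _ => hone ℓ,
    Finset.prod_univ_sum, Fintype.piFinset_univ]
  refine Finset.sum_congr rfl fun s _ => ?_
  rw [Finset.prod_univ_sum, Fintype.piFinset_univ]
  refine Finset.sum_congr rfl fun y _ => ?_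
  rw [Finset.prod_mul_distrib]
  rfl

end Averages

/-! ### Regularized divergences -/

section Divergence

variable {A : Type*} [Fintype A]

/-- A regularization of the Kullback-Leibler divergence (in nats). -/
noncomputable def regDiv (p q : A → ℝ) (η : ℝ) : ℝ :=
  ∑ a, p a * Real.log ((p a + η) / (q a + η))

theorem tendsto_regDiv {p q : A → ℝ} (hp : ∀ a, 0 ≤ p a)
    (h : ∀ a, q a = 0 → p a = 0) :
    Tendsto (regDiv p q) (𝓝[>] 0) (𝓝 (∑ a, p a * Real.log (p a / q a))) := by
  refine tendsto_finsetSum _ fun a _ => ?_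
  rcases (hp a).eq_or_lt with hpa | hpa
  · simp [← hpa]
  have hqa : q a ≠ 0 := fun h0 => hpa.ne' (h a h0)
  have : ContinuousAt (fun η : ℝ => p a * Real.log ((p a + η) / (q a + η))) 0 := by
    refine continuousAt_const.mul (ContinuousAt.log (ContinuousAt.div ?_ ?_ ?_) ?_)
    · fun_prop
    · fun_prop
    · simpa using hqa
    · simpa using div_ne_zero hpa.ne' hqa
  simpa [ContinuousAt] using this.tendsto.mono_left nhdsWithin_le_nhds

/-- A lower bound uniform in `η`, so that no term can offset another one that diverges to `+∞`. -/
theorem mul_log_ge {p q η : ℝ} (hp : 0 ≤ p) (hq : 0 ≤ q) (hη : η ∈ Set.Ioc (0 : ℝ) 1) :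
    p * Real.log (p / (q + 1)) ≤ p * Real.log ((p + η) / (q + η)) := by
  rcases hp.eq_or_lt with rfl | hp
  · simp
  have h0 := hη.1
  have h1 := hη.2
  refine mul_le_mul_of_nonneg_left (Real.log_le_log (by positivity) ?_) hp.le
  exact div_le_div₀ (by positivity) (by linarith) (by positivity) (by linarith)

theorem regDiv_ge {p q : A → ℝ} (hp : ∀ a, 0 ≤ p a) (hq : ∀ a, 0 ≤ q a) {η : ℝ}
    (hη : η ∈ Set.Ioc (0 : ℝ) 1) :
    ∑ a, p a * Real.log (p a / (q a + 1)) ≤ regDiv p q η :=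
  Finset.sum_le_sum fun a _ => mul_log_ge (hp a) (hq a) hη

theorem tendsto_sum_atTop_of_bddBelow {ι : Type*} [Fintype ι] {l : Filter ℝ} {f : ι → ℝ → ℝ}
    {c : ι → ℝ} (hc : ∀ i, ∀ᶠ x in l, c i ≤ f i x) {i₀ : ι} (h : Tendsto (f i₀) l atTop) :
    Tendsto (fun x => ∑ i, f i x) l atTop := by
  classical
  simp_rw [← Finset.add_sum_erase Finset.univ (fun i => f i _) (Finset.mem_univ i₀)]
  refine tendsto_atTop_add_right_of_le' l (∑ i ∈ Finset.univ.erase i₀, c i) h ?_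
  filter_upwards [eventually_all.2 hc] with x hx
  exact Finset.sum_le_sum fun i _ => hx i

theorem Ioc_mem_nhdsGT_zero_one : Set.Ioc (0 : ℝ) 1 ∈ 𝓝[>] (0 : ℝ) :=
  Ioc_mem_nhdsGT one_pos

theorem tendsto_regDiv_atTop {p q : A → ℝ} (hp : ∀ a, 0 ≤ p a) (hq : ∀ a, 0 ≤ q a)
    (h : ¬ ∀ a, q a = 0 → p a = 0) : Tendsto (regDiv p q) (𝓝[>] 0) atTop := by
  push Not at h
  obtain ⟨a, hqa, hpa⟩ := h
  have hpa : 0 < p a := lt_of_le_of_ne (hp a) (Ne.symm hpa)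
  refine tendsto_sum_atTop_of_bddBelow (i₀ := a) (c := fun a => p a * Real.log (p a / (q a + 1)))
    (fun a => ?_) ?_
  · filter_upwards [Ioc_mem_nhdsGT_zero_one] with η hη using mul_log_ge (hp a) (hq a) hη
  · refine Tendsto.const_mul_atTop hpa (Real.tendsto_log_atTop.comp ?_)
    simp only [hqa, zero_add]
    refine tendsto_atTop_mono' _ ?_ (Tendsto.const_mul_atTop hpa tendsto_inv_nhdsGT_zero)
    filter_upwards [self_mem_nhdsWithin] with η hη
    rw [← div_eq_mul_inv]
    have : (0 : ℝ) < η := hη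
    gcongr
    linarith

/-- As `η` decreases to `0`, either every relevant divergence is finite and the right side tends to
the positive quantity in `h`, or some term diverges while the others stay bounded below. In both
cases it beats `c * η`, which tends to `0`. -/
theorem exists_regDiv_gt {L B : Type*} [Fintype L] [Fintype B] {p q : L → A → ℝ}
    (hp : ∀ l a, 0 ≤ p l a) (hq : ∀ l a, 0 ≤ q l a) {r w : B → ℝ} (hr : ∀ b, 0 ≤ r b)
    (hw : ∀ b, 0 ≤ w b) (α : L → ℝ≥0) {R : ℝ} (hR : 0 < R) (c : ℝ)
    (h : (∀ l, α l ≠ 0 → ∀ a, q l a = 0 → p l a = 0) → (∀ b, w b = 0 → r b = 0) →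
      0 < ∑ l, (α l : ℝ) * ∑ a, p l a * Real.log (p l a / q l a) +
        R * ∑ b, r b * Real.log (r b / w b)) :
    ∃ η > 0, c * η < ∑ l, (α l : ℝ) * regDiv (p l) (q l) η + R * regDiv r w η := by
  have hc : Tendsto (fun η : ℝ => c * η) (𝓝[>] 0) (𝓝 0) := by
    have : ContinuousAt (fun η : ℝ => c * η) 0 := by fun_prop
    simpa [ContinuousAt] using this.tendsto.mono_left nhdsWithin_le_nhds
  have hbound : ∀ l, ∀ᶠ η in 𝓝[>] (0 : ℝ),
      (α l : ℝ) * ∑ a, p l a * Real.log (p l a / (q l a + 1)) ≤ α l * regDiv (p l) (q l) η := by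
    intro l
    filter_upwards [Ioc_mem_nhdsGT_zero_one] with η hη
    exact mul_le_mul_of_nonneg_left (regDiv_ge (hp l) (hq l) hη) (α l).2
  have hboundR : ∀ᶠ η in 𝓝[>] (0 : ℝ),
      R * ∑ b, r b * Real.log (r b / (w b + 1)) ≤ R * regDiv r w η := by
    filter_upwards [Ioc_mem_nhdsGT_zero_one] with η hη
    exact mul_le_mul_of_nonneg_left (regDiv_ge hr hw hη) hR.le
  suffices H : ∀ᶠ η in 𝓝[>] (0 : ℝ),
      c * η < ∑ l, (α l : ℝ) * regDiv (p l) (q l) η + R * regDiv r w η by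
    obtain ⟨η, h1, h2⟩ := (H.and self_mem_nhdsWithin).exists
    exact ⟨η, h2, h1⟩
  have htop : ∀ {F : ℝ → ℝ}, Tendsto F (𝓝[>] 0) atTop → ∀ᶠ η in 𝓝[>] (0 : ℝ), c * η < F η := by
    intro F hF
    filter_upwards [hF.eventually_ge_atTop 1, hc.eventually_lt_const one_pos] with η h1 h2
    linarith
  by_cases h1 : ∀ l, α l ≠ 0 → ∀ a, q l a = 0 → p l a = 0
  · have hlim : Tendsto (fun η => ∑ l, (α l : ℝ) * regDiv (p l) (q l) η) (𝓝[>] 0)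
        (𝓝 (∑ l, (α l : ℝ) * ∑ a, p l a * Real.log (p l a / q l a))) := by
      refine tendsto_finsetSum _ fun l _ => ?_
      by_cases hl : α l = 0
      · simp [hl]
      · exact (tendsto_regDiv (hp l) (h1 l hl)).const_mul _
    by_cases h2 : ∀ b, w b = 0 → r b = 0
    · exact hc.eventually_lt (hlim.add ((tendsto_regDiv hr h2).const_mul R)) (h h1 h2)
    · exact htop (hlim.add_atTop ((tendsto_regDiv_atTop hr hw h2).const_mul_atTop hR))
  · push Not at h1
    obtain ⟨l, hl, a, ha⟩ := h1
    refine htop (tendsto_atTop_add_right_of_le' _ _ (tendsto_sum_atTop_of_bddBelow hbound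
      (i₀ := l) ?_) hboundR)
    refine (tendsto_regDiv_atTop (hp l) (hq l) ?_).const_mul_atTop (by positivity)
    exact fun hc => ha.2 (hc a ha.1)

theorem sum_mul_log_div_nonneg {p q : A → ℝ} (hp : p ∈ stdSimplex ℝ A) (hq : q ∈ stdSimplex ℝ A)
    (h : ∀ a, q a = 0 → p a = 0) : 0 ≤ ∑ a, p a * Real.log (p a / q a) := by
  have : ∀ a, p a - q a ≤ p a * Real.log (p a / q a) := by
    intro a
    rcases (hp.1 a).eq_or_lt with hpa | hpa
    · simp [← hpa, hq.1 a]
    have hqa : 0 < q a := lt_of_le_of_ne (hq.1 a) fun h0 => hpa.ne' (h a h0.symm)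
    have := mul_le_mul_of_nonneg_left (Real.one_sub_inv_le_log_of_pos (div_pos hpa hqa)) hpa.le
    refine le_trans (le_of_eq ?_) this
    field_simp
  calc (0 : ℝ) = ∑ a, (p a - q a) := by rw [Finset.sum_sub_distrib, hp.2, hq.2, sub_self]
    _ ≤ _ := Finset.sum_le_sum fun a _ => this a

theorem klDist_eq_ofReal {p q : A → ℝ} (h : ∀ a, q a = 0 → p a = 0) :
    klDist p q = ENNReal.ofReal ((∑ a, p a * Real.log (p a / q a)) / Real.log 2) := by
  rw [klDist, if_pos h, Finset.sum_div]
  simp_rw [Real.logb, mul_div_assoc]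

end Divergence

/-! ### The lower bound as positivity of an exponent -/

section Bound

variable {V X Y L : Type*} [Fintype V] [DecidableEq V] [Fintype X] [DecidableEq X] [Fintype Y]

theorem sndMarginal_mem {lam : V × V → ℝ} (h : lam ∈ stdSimplex ℝ (V × V)) :
    sndMarginal lam ∈ stdSimplex ℝ V := by
  refine ⟨fun b => Finset.sum_nonneg fun a _ => h.1 _, ?_⟩
  rw [← h.2, Fintype.sum_prod_type_right]
  rfl

/-- The entropy of the second marginal cancels against the same term in its divergence from `P`.
What remains is minus the divergence of `lam` from counting measure times `P`, the growth exponent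
of prior-weighted pairs of that joint type. -/
theorem denominator_eq {P : V → ℝ} (hP : P ∈ stdSimplex ℝ V) {lam : V × V → ℝ}
    (hlam : lam ∈ stdSimplex ℝ (V × V)) (h : ∀ ab : V × V, P ab.2 = 0 → lam ab = 0) :
    denominator P lam =
      ((-(∑ ab, lam ab * Real.log (lam ab / P ab.2)) / Real.log 2 : ℝ) : EReal) := by
  have hm := sndMarginal_mem hlam
  have hac : ∀ b, P b = 0 → sndMarginal lam b = 0 :=
    fun b hb => Finset.sum_eq_zero fun a _ => h (a, b) hb
  have hnn := sum_mul_log_div_nonneg hm hP hac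
  have hlog2 : 0 < Real.log 2 := Real.log_pos one_lt_two
  rw [denominator, klDist_eq_ofReal hac, EReal.coe_ennreal_ofReal,
    max_eq_left (div_nonneg hnn hlog2.le), ← EReal.coe_sub]
  congr 1
  have e1 : ∑ b, sndMarginal lam b * Real.log (sndMarginal lam b / P b) =
      ∑ b, sndMarginal lam b * Real.log (sndMarginal lam b) -
        ∑ b, sndMarginal lam b * Real.log (P b) := by
    rw [← Finset.sum_sub_distrib]
    refine Finset.sum_congr rfl fun b _ => ?_
    by_cases h0 : sndMarginal lam b = 0
    · simp [h0]
    · rw [Real.log_div h0 (fun hb => h0 (hac b hb)), mul_sub]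
  have e2 : ∑ ab, lam ab * Real.log (lam ab / P ab.2) =
      ∑ ab, lam ab * Real.log (lam ab) - ∑ b, sndMarginal lam b * Real.log (P b) := by
    have : ∑ b, sndMarginal lam b * Real.log (P b) = ∑ ab, lam ab * Real.log (P ab.2) := by
      rw [Fintype.sum_prod_type_right]
      simp_rw [sndMarginal, Finset.sum_mul]
    rw [this, ← Finset.sum_sub_distrib]
    refine Finset.sum_congr rfl fun b _ => ?_
    by_cases h0 : lam b = 0
    · simp [h0]
    · rw [Real.log_div h0 (fun hb => h0 (h b hb)), mul_sub]
  rw [e1, e2]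
  simp only [entropy, Real.logb, mul_div_assoc', ← Finset.sum_div]
  ring

/-- `R < numerator / denominator` with the denominator cleared; passing from bits to nats multiplies
both by `Real.log 2`. -/
theorem sum_divergence_pos_of_lt_lowerBound [Fintype L] {S : L → SensorClass V X Y} {α : L → ℝ≥0}
    {P : V → ℝ} (hP : P ∈ stdSimplex ℝ V) {D : ℝ} {R : ℝ≥0} (hR0 : 0 < R)
    (hR : (R : ℝ≥0∞) < lowerBound S α P D) {lam : V × V → ℝ} (hlam : lam ∈ feasible P D)
    (hdist : ∀ l, distP (S l) P ∈ stdSimplex ℝ (X × Y))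
    (h1 : ∀ l, α l ≠ 0 → ∀ z, distQ (S l) lam z = 0 → distP (S l) P z = 0)
    (h2 : ∀ ab : V × V, P ab.2 = 0 → lam ab = 0) :
    0 < ∑ l, (α l : ℝ) * ∑ z, distP (S l) P z * Real.log (distP (S l) P z / distQ (S l) lam z) +
        R * ∑ ab : V × V, lam ab * Real.log (lam ab / P ab.2) := by
  have hlog2 : 0 < Real.log 2 := Real.log_pos one_lt_two
  set N := ∑ l, (α l : ℝ) *
    ∑ z, distP (S l) P z * Real.log (distP (S l) P z / distQ (S l) lam z) with hN
  set d := ∑ ab : V × V, lam ab * Real.log (lam ab / P ab.2) with hd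
  have hterm : ∀ l, 0 ≤ (α l : ℝ) *
      ∑ z, distP (S l) P z * Real.log (distP (S l) P z / distQ (S l) lam z) := by
    intro l
    by_cases hl : α l = 0
    · simp [hl]
    · exact mul_nonneg (α l).2 (sum_mul_log_div_nonneg (hdist l)
        ⟨distQ_nonneg _ hlam.1.1, sum_distQ _ hlam.1⟩ (h1 l hl))
  have hNnn : 0 ≤ N := Finset.sum_nonneg fun l _ => hterm l
  have hnum : numerator S α P lam = ENNReal.ofReal (N / Real.log 2) := by
    rw [numerator, hN, Finset.sum_div, ENNReal.ofReal_sum_of_nonneg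
      fun l _ => div_nonneg (hterm l) hlog2.le]
    refine Finset.sum_congr rfl fun l _ => ?_
    by_cases hl : α l = 0
    · simp [hl]
    · rw [klDist_eq_ofReal (h1 l hl), mul_div_assoc, ENNReal.ofReal_mul (NNReal.coe_nonneg _),
        ENNReal.ofReal_coe_nnreal]
  have hden := denominator_eq hP hlam.1 h2
  rw [← hd] at hden
  have hR0' : (0 : ℝ) < R := hR0
  -- Here the denominator is negative and `lam` is outside the minimum, but `R * d` is already
  -- positive.
  by_cases hd0 : 0 < d
  · positivity
  push Not at hd0
  have hdd : 0 ≤ -d / Real.log 2 := div_nonneg (by linarith) hlog2.le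
  have hlt : (R : ℝ≥0∞) < numerator S α P lam / (denominator P lam).toENNReal := by
    refine hR.trans_le (iInf₂_le_of_le lam hlam (iInf_le_of_le ?_ le_rfl))
    rw [hden]
    exact_mod_cast hdd
  rw [hden, hnum, EReal.toENNReal_of_ne_top (EReal.coe_ne_top _), EReal.toReal_coe] at hlt
  -- A zero numerator makes the ratio `0`, even over a zero denominator, contradicting `R` below it.
  rcases hNnn.eq_or_lt with h0 | h0
  · simp [← h0] at hlt
  -- With a zero denominator the ratio is infinite, and positivity comes from the numerator alone.
  rcases hd0.eq_or_lt with hz | hz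
  · rw [hz]; linarith
  have hdpos : 0 < -d / Real.log 2 := div_pos (by linarith) hlog2
  rw [← ENNReal.ofReal_div_of_pos hdpos, ← ENNReal.ofReal_coe_nnreal,
    ENNReal.ofReal_lt_ofReal_iff (by positivity), lt_div_iff₀ hdpos, mul_div_assoc',
    div_lt_div_iff_of_pos_right hlog2] at hlt
  linarith

end Bound

/-! ### Confusion events and atypical target vectors -/

section Confusion

variable {V X Y L : Type*} [Fintype V] [DecidableEq V] [Fintype X] [DecidableEq X] [Fintype Y]

theorem likelihood_nonneg (S : L → SensorClass V X Y) {n k : ℕ} {cls : Fin n → L}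
    (s : Network S cls k) (v : Fin k → V) (y : Fin n → Y) : 0 ≤ likelihood S s v y :=
  Finset.prod_nonneg fun ℓ _ => ((S (cls ℓ)).noise_mem _).1 _

theorem sum_prod_eq_pow {A : Type*} [Fintype A] (w : A → ℝ) (k : ℕ) :
    ∑ v : Fin k → A, ∏ t, w (v t) = (∑ a, w a) ^ k := by
  rw [← Fintype.piFinset_univ, ← Finset.prod_univ_sum (fun _ => Finset.univ) fun _ a => w a]
  simp

theorem sum_likelihood (S : L → SensorClass V X Y) {n k : ℕ} {cls : Fin n → L}
    (s : Network S cls k) (v : Fin k → V) : ∑ y, likelihood S s v y = 1 := by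
  unfold likelihood
  rw [← Fintype.piFinset_univ, ← Finset.prod_univ_sum (fun _ => Finset.univ)
    fun ℓ y => (S (cls ℓ)).noise (idealOutput S s v ℓ) y]
  exact Finset.prod_eq_one fun ℓ _ => ((S (cls ℓ)).noise_mem _).2

theorem priorProb_nonneg {P : V → ℝ} (hP : P ∈ stdSimplex ℝ V) {k : ℕ} (v : Fin k → V) :
    0 ≤ priorProb P v :=
  Finset.prod_nonneg fun _ _ => hP.1 _

theorem sum_priorProb {P : V → ℝ} (hP : P ∈ stdSimplex ℝ V) (k : ℕ) :
    ∑ v : Fin k → V, priorProb P v = 1 := by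
  unfold priorProb
  rw [sum_prod_eq_pow, hP.2, one_pow]

open Classical in
/-- The probability that some vector, whose joint type with the true target vector belongs to `U`,
has at least the posterior probability of the true target vector. -/
noncomputable def confusionProb (S : L → SensorClass V X Y) (P : V → ℝ) {n k : ℕ}
    {cls : Fin n → L} (s : Network S cls k) (U : Set (V × V → ℝ)) : ℝ :=
  ∑ v : Fin k → V, ∑ y, priorProb P v * likelihood S s v y *
    (if ∃ v', jointType v v' ∈ U ∧
      priorProb P v * likelihood S s v y ≤ priorProb P v' * likelihood S s v' y then 1 else 0)

/-- The average of `confusionProb` over all networks. -/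
noncomputable def avgConfusionProb (S : L → SensorClass V X Y) (P : V → ℝ) {n : ℕ}
    (cls : Fin n → L) (k : ℕ) (U : Set (V × V → ℝ)) : ℝ :=
  (∑ s : Network S cls k, confusionProb S P s U) / Fintype.card (Network S cls k)

theorem joint_nonneg (S : L → SensorClass V X Y) {P : V → ℝ} (hP : P ∈ stdSimplex ℝ V) {n k : ℕ}
    {cls : Fin n → L} (s : Network S cls k) (v : Fin k → V) (y : Fin n → Y) :
    0 ≤ priorProb P v * likelihood S s v y :=
  mul_nonneg (priorProb_nonneg hP v) (likelihood_nonneg S s v y)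

theorem confusionProb_nonneg (S : L → SensorClass V X Y) {P : V → ℝ} (hP : P ∈ stdSimplex ℝ V)
    {n k : ℕ} {cls : Fin n → L} (s : Network S cls k) (U : Set (V × V → ℝ)) :
    0 ≤ confusionProb S P s U :=
  Finset.sum_nonneg fun v _ => Finset.sum_nonneg fun y _ =>
    mul_nonneg (joint_nonneg S hP s v y) (by split_ifs <;> norm_num)

theorem avgConfusionProb_nonneg (S : L → SensorClass V X Y) {P : V → ℝ} (hP : P ∈ stdSimplex ℝ V)
    {n : ℕ} (cls : Fin n → L) (k : ℕ) (U : Set (V × V → ℝ)) :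
    0 ≤ avgConfusionProb S P cls k U :=
  div_nonneg (Finset.sum_nonneg fun s _ => confusionProb_nonneg S hP s U) (Nat.cast_nonneg _)

theorem avgConfusionProb_empty (S : L → SensorClass V X Y) (P : V → ℝ)
    {n : ℕ} (cls : Fin n → L) (k : ℕ) : avgConfusionProb S P cls k ∅ = 0 := by
  simp [avgConfusionProb, confusionProb]

theorem avgConfusionProb_mono (S : L → SensorClass V X Y) {P : V → ℝ} (hP : P ∈ stdSimplex ℝ V)
    {n : ℕ} (cls : Fin n → L) (k : ℕ) {U U' : Set (V × V → ℝ)} (h : U ⊆ U') :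
    avgConfusionProb S P cls k U ≤ avgConfusionProb S P cls k U' := by
  refine div_le_div_of_nonneg_right (Finset.sum_le_sum fun s _ => Finset.sum_le_sum fun v _ =>
    Finset.sum_le_sum fun y _ => mul_le_mul_of_nonneg_left ?_ (joint_nonneg S hP s v y))
    (Nat.cast_nonneg _)
  split_ifs with h1 h2
  · exact le_rfl
  · exact absurd (h1.imp fun v' hv' => ⟨h hv'.1, hv'.2⟩) h2
  · exact zero_le_one
  · exact le_rfl

theorem avgConfusionProb_union_le (S : L → SensorClass V X Y) {P : V → ℝ}
    (hP : P ∈ stdSimplex ℝ V) {n : ℕ} (cls : Fin n → L) (k : ℕ) (U U' : Set (V × V → ℝ)) :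
    avgConfusionProb S P cls k (U ∪ U') ≤
      avgConfusionProb S P cls k U + avgConfusionProb S P cls k U' := by
  unfold avgConfusionProb
  rw [← add_div, ← Finset.sum_add_distrib]
  refine div_le_div_of_nonneg_right (Finset.sum_le_sum fun s _ => ?_) (Nat.cast_nonneg _)
  unfold confusionProb
  simp_rw [← Finset.sum_add_distrib]
  refine Finset.sum_le_sum fun v _ => Finset.sum_le_sum fun y _ => ?_
  rw [← mul_add]
  refine mul_le_mul_of_nonneg_left ?_ (joint_nonneg S hP s v y)
  by_cases h1 : ∃ v', jointType v v' ∈ U ∧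
      priorProb P v * likelihood S s v y ≤ priorProb P v' * likelihood S s v' y
  · rw [if_pos h1]
    split_ifs <;> norm_num
  by_cases h2 : ∃ v', jointType v v' ∈ U' ∧
      priorProb P v * likelihood S s v y ≤ priorProb P v' * likelihood S s v' y
  · rw [if_pos h2]
    split_ifs <;> norm_num
  rw [if_neg, if_neg h1, if_neg h2, add_zero]
  rintro ⟨v', h | h, hv'⟩
  · exact h1 ⟨v', h, hv'⟩
  · exact h2 ⟨v', h, hv'⟩

theorem sum_jointType_mul {k : ℕ} (v v' : Fin k → V) (G : V × V → ℝ) :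
    ∑ ab, jointType v v' ab * G ab = (∑ t, G (v t, v' t)) / k := by
  simp_rw [jointType, div_mul_eq_mul_div, ← Finset.sum_div]
  congr 1
  rw [← Finset.sum_fiberwise Finset.univ (fun t => (v t, v' t))]
  refine Finset.sum_congr rfl fun ab _ => ?_
  rw [Finset.sum_congr rfl (g := fun _ => G ab)
    fun t ht => congrArg G (Finset.mem_filter.1 ht).2]
  simp

theorem jointType_mem_stdSimplex {k : ℕ} (hk : k ≠ 0) (v v' : Fin k → V) :
    jointType v v' ∈ stdSimplex ℝ (V × V) := by
  refine ⟨fun ab => by unfold jointType; positivity, ?_⟩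
  have := sum_jointType_mul v v' 1
  simp only [Pi.one_apply, mul_one] at this
  simp [this, hk]

/-- Supplies Chernoff parameters: a negative derivative at `0` makes a small positive `t` work. -/
theorem exists_pos_neg_of_hasDerivAt {φ : ℝ → ℝ} {d : ℝ} (hφ : HasDerivAt φ d 0) (h0 : φ 0 = 0)
    (hd : d < 0) : ∃ t > 0, φ t < 0 := by
  have h := (hasDerivAt_iff_tendsto_slope.1 hφ).mono_left
    (nhdsWithin_mono (0 : ℝ) (s := Set.Ioi 0) fun x hx => ne_of_gt hx)
  obtain ⟨t, ht, ht0⟩ := ((h.eventually_lt_const hd).and self_mem_nhdsWithin).exists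
  refine ⟨t, ht0, ?_⟩
  have ht0 : 0 < t := ht0
  rw [slope_def_field, h0, sub_zero, sub_zero, div_neg_iff] at ht
  rcases ht with h | h
  · linarith [h.2]
  · exact h.1

/-- Drops the posterior comparison, leaving an event about `v` alone; the observations then sum out.
-/
theorem avgConfusionProb_le_sum_priorProb (S : L → SensorClass V X Y) {P : V → ℝ}
    (hP : P ∈ stdSimplex ℝ V) {n : ℕ} (cls : Fin n → L) (k : ℕ) (U : Set (V × V → ℝ))
    (F : (Fin k → V) → ℝ) (hF : ∀ v, 0 ≤ F v) (hF1 : ∀ v v', jointType v v' ∈ U → 1 ≤ F v) :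
    avgConfusionProb S P cls k U ≤ ∑ v, priorProb P v * F v := by
  refine div_le_of_le_mul₀ (Nat.cast_nonneg _)
    (Finset.sum_nonneg fun v _ => mul_nonneg (priorProb_nonneg hP v) (hF v)) ?_
  rw [mul_comm, ← nsmul_eq_mul, ← Finset.card_univ, ← Finset.sum_const]
  refine Finset.sum_le_sum fun s _ => Finset.sum_le_sum fun v _ => ?_
  calc _ ≤ ∑ y, priorProb P v * likelihood S s v y * F v := by
        refine Finset.sum_le_sum fun y _ => mul_le_mul_of_nonneg_left ?_ (joint_nonneg S hP s v y)
        split_ifs with h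
        · exact hF1 v _ h.choose_spec.1
        · exact hF v
    _ = _ := by rw [← Finset.sum_mul, ← Finset.mul_sum, sum_likelihood, mul_one]

theorem exists_nhds_tendsto_of_fst_marginal_ne (S : L → SensorClass V X Y) {P : V → ℝ}
    (hP : P ∈ stdSimplex ℝ V) (cls : (n : ℕ) → Fin n → L) {k : ℕ → ℕ} (hk : Tendsto k atTop atTop)
    {lam : V × V → ℝ} (hne : ∃ a, ∑ b, lam (a, b) ≠ P a) :
    ∃ U ∈ 𝓝 lam, Tendsto (fun n => avgConfusionProb S P (cls n) (k n) U) atTop (𝓝 0) := by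
  -- The marginal discrepancy is itself a separating functional: its means under `lam` and `P`
  -- differ by the sum of its squares.
  set h : V → ℝ := fun a => ∑ b, lam (a, b) - P a with hh
  have hlt : ∑ a, P a * h a < ∑ ab : V × V, lam ab * h ab.1 := by
    have : ∑ ab : V × V, lam ab * h ab.1 = ∑ a, (∑ b, lam (a, b)) * h a := by
      rw [Fintype.sum_prod_type]
      simp_rw [Finset.sum_mul]
    rw [this, ← sub_pos, ← Finset.sum_sub_distrib]
    simp_rw [← sub_mul]
    obtain ⟨a, ha⟩ := hne
    exact Finset.sum_pos' (fun a _ => mul_self_nonneg _)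
      ⟨a, Finset.mem_univ a, mul_self_pos.2 (sub_ne_zero.2 ha)⟩
  obtain ⟨θ, hθ1, hθ2⟩ := exists_between hlt
  -- The derivative at `0` is the mean of `h` under `P` minus `θ`, which is negative.
  obtain ⟨t, ht0, ht⟩ : ∃ t > 0, ∑ a, P a * Real.exp (t * (h a - θ)) - 1 < 0 := by
    refine exists_pos_neg_of_hasDerivAt (d := ∑ a, P a * (h a - θ)) ?_ (by simp [hP.2]) ?_
    · refine HasDerivAt.sub_const _ (HasDerivAt.fun_sum fun a _ => HasDerivAt.const_mul _ ?_)
      simpa using ((hasDerivAt_id (0 : ℝ)).mul_const (h a - θ)).exp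
    · simp_rw [mul_sub, Finset.sum_sub_distrib, ← Finset.sum_mul, hP.2]
      linarith
  refine ⟨{μ | θ < ∑ ab : V × V, μ ab * h ab.1},
    (isOpen_lt continuous_const (by fun_prop)).mem_nhds hθ2, ?_⟩
  refine squeeze_zero (fun n => avgConfusionProb_nonneg S hP _ _ _) (fun n =>
    avgConfusionProb_le_sum_priorProb S hP (cls n) (k n) _
      (fun v => ∏ i, Real.exp (t * (h (v i) - θ)))
      (fun v => Finset.prod_nonneg fun i _ => (Real.exp_pos _).le) ?_)
    ((tendsto_pow_atTop_nhds_zero_of_lt_one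
      (Finset.sum_nonneg fun a _ => mul_nonneg (hP.1 a) (Real.exp_pos _).le)
      (sub_neg.1 ht)).comp hk |>.congr fun n => ?_)
  · intro v v' hU
    rw [Set.mem_ofPred_eq, sum_jointType_mul v v' fun ab => h ab.1] at hU
    rw [← Real.exp_sum, Real.one_le_exp_iff, ← Finset.mul_sum]
    refine mul_nonneg ht0.le ?_
    rcases Nat.eq_zero_or_pos (k n) with h0 | h0
    · have : IsEmpty (Fin (k n)) := by rw [h0]; infer_instance
      simp
    · rw [lt_div_iff₀ (by positivity)] at hU
      rw [Finset.sum_sub_distrib]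
      simp
      linarith
  · simp only [Function.comp, priorProb, ← Finset.prod_mul_distrib]
    rw [sum_prod_eq_pow fun a => P a * Real.exp (t * (h a - θ))]

end Confusion

/-! ### Exponential bounds near a joint type -/

section Feasible

variable {V X Y L : Type*} [Fintype V] [DecidableEq V] [Fintype X] [DecidableEq X] [Fintype Y]
  [Fintype L] [DecidableEq L]

/-- The fraction of sensors of class `l`. -/
noncomputable def classFreq {n : ℕ} (cls : Fin n → L) (l : L) : ℝ :=
  ((Finset.univ.filter fun ℓ => cls ℓ = l).card : ℝ) / n

theorem sum_comp_cls {n : ℕ} (hn : n ≠ 0) (cls : Fin n → L) (φ : L → ℝ) :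
    ∑ ℓ, φ (cls ℓ) = n * ∑ l, classFreq cls l * φ l := by
  rw [← Finset.sum_fiberwise Finset.univ cls, Finset.mul_sum]
  refine Finset.sum_congr rfl fun l _ => ?_
  rw [Finset.sum_congr rfl (g := fun _ => φ l)
    fun t ht => congrArg φ (Finset.mem_filter.1 ht).2]
  rw [Finset.sum_const, nsmul_eq_mul, classFreq]
  field_simp

/-- The sum of `φ - 1` moments that bounds the logarithm of a product of moments. -/
noncomputable def momentExponent (S : L → SensorClass V X Y) (ν : L → ℝ) (lam : V × V → ℝ)
    (g : L → X × Y → ℝ) : ℝ :=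
  ∑ l, ν l * (∑ z, distQ (S l) lam z * Real.exp (g l z) - 1)

/-- Bounding each factor by `x ≤ exp (x - 1)` makes the exponent linear in the class frequencies,
hence continuous as these converge. -/
theorem sum_network_likelihood_mul_exp_le (S : L → SensorClass V X Y) {n k : ℕ} (hn : n ≠ 0)
    (hk : k ≠ 0) (cls : Fin n → L) (v v' : Fin k → V) (g : L → X × Y → ℝ) :
    ∑ s : Network S cls k, ∑ y, likelihood S s v' y *
        Real.exp (∑ ℓ, g (cls ℓ) (idealOutput S s v ℓ, y ℓ)) ≤
      Fintype.card (Network S cls k) *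
        Real.exp (n * momentExponent S (classFreq cls) (jointType v v') g) := by
  simp_rw [Real.exp_sum]
  rw [sum_network_likelihood_mul_prod S hk cls v v' fun l z => Real.exp (g l z)]
  refine mul_le_mul_of_nonneg_left ?_ (Nat.cast_nonneg _)
  rw [momentExponent, ← sum_comp_cls hn cls fun l =>
    ∑ z, distQ (S l) (jointType v v') z * Real.exp (g l z) - 1, Real.exp_sum]
  refine Finset.prod_le_prod (fun ℓ _ => Finset.sum_nonneg fun z _ => mul_nonneg
    (distQ_nonneg _ (jointType_mem_stdSimplex hk v v').1 z) (Real.exp_pos _).le) fun ℓ _ => ?_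
  have := Real.add_one_le_exp
    (∑ z, distQ (S (cls ℓ)) (jointType v v') z * Real.exp (g (cls ℓ) z) - 1)
  linarith

/-- A change of measure in place of counting type classes: the prior of `v'` is at most the product
weight `w + η` times an exponential of a linear functional of the joint type. The total product
weight is at most `exp (k η |V × V|)`, which `hA` pays for. -/
theorem sum_priorProb_le_exp {P : V → ℝ} (hP : P ∈ stdSimplex ℝ V) {k : ℕ} (hk : k ≠ 0)
    {w : V × V → ℝ} (hw : w ∈ stdSimplex ℝ (V × V)) {η : ℝ} (hη : 0 < η)
    (A : (Fin k → V) → (Fin k → V) → ℝ) {C : ℝ}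
    (hA : ∀ v v', A v v' * Real.exp (k * (∑ ab, jointType v v' ab *
      Real.log ((P ab.2 + η) / (w ab + η)) + η * Fintype.card (V × V))) ≤ C)
    (hA0 : ∀ v v', 0 ≤ A v v') :
    ∑ v, ∑ v', priorProb P v' * A v v' ≤ C := by
  have hpos : ∀ ab, 0 < w ab + η := fun ab => add_pos_of_nonneg_of_pos (hw.1 ab) hη
  set W : (Fin k → V) → (Fin k → V) → ℝ := fun v v' => ∏ t, (w (v t, v' t) + η) with hW
  have hW0 : ∀ v v', 0 ≤ W v v' := fun v v' => Finset.prod_nonneg fun t _ => (hpos _).le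
  have hsum : ∑ v, ∑ v', W v v' ≤ Real.exp (k * (η * Fintype.card (V × V))) := by
    have h1 : ∑ v, ∑ v', W v v' = (∑ ab, (w ab + η)) ^ k := by
      have h2 : ∀ v, ∑ v', W v v' = ∏ t, ∑ b, (w (v t, b) + η) := by
        intro v
        rw [Finset.prod_univ_sum, Fintype.piFinset_univ]
      simp_rw [h2]
      rw [sum_prod_eq_pow fun a => ∑ b, (w (a, b) + η), Fintype.sum_prod_type]
    rw [h1, Finset.sum_add_distrib, hw.2, Real.exp_nat_mul]
    refine pow_le_pow_left₀ (by positivity) ?_ k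
    have := Real.add_one_le_exp (η * Fintype.card (V × V))
    simp at this ⊢
    linarith
  have hprior : ∀ v v' : Fin k → V, priorProb P v' ≤ W v v' *
      Real.exp (k * ∑ ab, jointType v v' ab * Real.log ((P ab.2 + η) / (w ab + η))) := by
    intro v v'
    rw [sum_jointType_mul v v' fun ab => Real.log ((P ab.2 + η) / (w ab + η)),
      mul_div_cancel₀ _ (Nat.cast_ne_zero.2 hk), Real.exp_sum, hW, ← Finset.prod_mul_distrib]
    refine Finset.prod_le_prod (fun t _ => hP.1 _) fun t _ => ?_
    have hPpos : 0 < P (v' t) + η := add_pos_of_nonneg_of_pos (hP.1 _) hη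
    rw [Real.exp_log (div_pos hPpos (hpos _)), mul_div_cancel₀ _ (hpos _).ne']
    linarith
  have key : ∀ v v', priorProb P v' * A v v' ≤
      W v v' * (C * Real.exp (-(k * (η * Fintype.card (V × V))))) := by
    intro v v'
    refine (mul_le_mul_of_nonneg_right (hprior v v') (hA0 v v')).trans ?_
    rw [mul_assoc]
    refine mul_le_mul_of_nonneg_left ?_ (hW0 v v')
    rw [Real.exp_neg, ← div_eq_mul_inv, le_div_iff₀ (Real.exp_pos _)]
    refine le_trans (le_of_eq ?_) (hA v v')
    rw [mul_add, Real.exp_add]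
    ring
  -- A constant vector is needed to instantiate `hA`; `V` is nonempty because `P` sums to `1`.
  have hC : 0 ≤ C := by
    obtain ⟨a, -⟩ : ∃ a, P a ≠ 0 := by
      by_contra! h
      simpa [h] using hP.2
    exact (mul_nonneg (hA0 _ _) (Real.exp_pos _).le).trans (hA (fun _ => a) fun _ => a)
  calc _ ≤ ∑ v, ∑ v', W v v' * (C * Real.exp (-(k * (η * Fintype.card (V × V))))) :=
        Finset.sum_le_sum fun v _ => Finset.sum_le_sum fun v' _ => key v v'
    _ = (∑ v, ∑ v', W v v') * (C * Real.exp (-(k * (η * Fintype.card (V × V))))) := by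
        simp_rw [Finset.sum_mul]
    _ ≤ Real.exp (k * (η * Fintype.card (V × V))) *
          (C * Real.exp (-(k * (η * Fintype.card (V × V))))) :=
        mul_le_mul_of_nonneg_right hsum (mul_nonneg hC (Real.exp_pos _).le)
    _ = C := by
        rw [mul_left_comm, ← Real.exp_add, add_neg_cancel, Real.exp_zero, mul_one]

-- Split at `F ≤ n θ`. Below the threshold, `exp (t (n θ - F)) ≥ 1` bounds the event under `v`.
-- Above it, the weight of `v` is at most that of the competitor, which `exp (F - n θ) ≥ 1` only
-- enlarges. The union bound over `v'` thus weighs each pair by the prior of `v'`, not of `v`.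
open Classical in
theorem confusionProb_le (S : L → SensorClass V X Y) {P : V → ℝ} (hP : P ∈ stdSimplex ℝ V)
    {n k : ℕ} {cls : Fin n → L} (s : Network S cls k) (U : Set (V × V → ℝ))
    (f : L → X × Y → ℝ) (θ : ℝ) {t : ℝ} (ht : 0 ≤ t) :
    confusionProb S P s U ≤
      ∑ v : Fin k → V, priorProb P v * ((if ∃ v', jointType v v' ∈ U then 1 else 0) *
        (Real.exp (n * (t * θ)) * ∑ y, likelihood S s v y *
          Real.exp (∑ ℓ, -t * f (cls ℓ) (idealOutput S s v ℓ, y ℓ)))) +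
      ∑ v : Fin k → V, ∑ v' : Fin k → V, priorProb P v' *
        ((if jointType v v' ∈ U then 1 else 0) * (Real.exp (n * -θ) *
          ∑ y, likelihood S s v' y * Real.exp (∑ ℓ, f (cls ℓ) (idealOutput S s v ℓ, y ℓ)))) := by
  rw [← Finset.sum_add_distrib]
  refine Finset.sum_le_sum fun v _ => ?_
  simp_rw [Finset.mul_sum]
  rw [Finset.sum_comm (s := (Finset.univ : Finset (Fin k → V))), ← Finset.sum_add_distrib]
  refine Finset.sum_le_sum fun y _ => ?_
  set F := ∑ ℓ, f (cls ℓ) (idealOutput S s v ℓ, y ℓ) with hF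
  have h2 : ∀ v', 0 ≤ priorProb P v' * ((if jointType v v' ∈ U then (1 : ℝ) else 0) *
      (Real.exp (n * -θ) * (likelihood S s v' y * Real.exp F))) := fun v' =>
    mul_nonneg (priorProb_nonneg hP v') (mul_nonneg (by split_ifs <;> norm_num)
      (mul_nonneg (Real.exp_pos _).le (mul_nonneg (likelihood_nonneg S s v' y)
        (Real.exp_pos _).le)))
  have h1 : 0 ≤ priorProb P v * ((if ∃ v', jointType v v' ∈ U then (1 : ℝ) else 0) *
      (Real.exp (n * (t * θ)) * (likelihood S s v y *
        Real.exp (∑ ℓ, -t * f (cls ℓ) (idealOutput S s v ℓ, y ℓ))))) :=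
    mul_nonneg (priorProb_nonneg hP v) (mul_nonneg (by split_ifs <;> norm_num)
      (mul_nonneg (Real.exp_pos _).le (mul_nonneg (likelihood_nonneg S s v y)
        (Real.exp_pos _).le)))
  by_cases h : ∃ v', jointType v v' ∈ U ∧
      priorProb P v * likelihood S s v y ≤ priorProb P v' * likelihood S s v' y
  · rw [if_pos h, mul_one]
    obtain ⟨v', hv', hle⟩ := h
    by_cases hFθ : F ≤ n * θ
    · refine le_add_of_le_of_nonneg ?_ (Finset.sum_nonneg fun v' _ => h2 v')
      rw [if_pos ⟨v', hv'⟩, one_mul, mul_left_comm (Real.exp _), ← mul_assoc, ← Real.exp_add,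
        ← Finset.mul_sum, ← hF]
      refine le_mul_of_one_le_right (joint_nonneg S hP s v y) (Real.one_le_exp ?_)
      have := mul_le_mul_of_nonneg_left hFθ ht
      linarith
    · refine le_add_of_nonneg_of_le h1 (hle.trans ?_)
      refine le_trans ?_ (Finset.single_le_sum (fun v' _ => h2 v') (Finset.mem_univ v'))
      rw [if_pos hv', one_mul, mul_left_comm (Real.exp _), ← mul_assoc, ← Real.exp_add]
      refine le_mul_of_one_le_right (joint_nonneg S hP s v' y) (Real.one_le_exp ?_)
      linarith
  · rw [if_neg h, mul_zero]
    exact add_nonneg h1 (Finset.sum_nonneg fun v' _ => h2 v')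

theorem avgConfusionProb_le_exp (S : L → SensorClass V X Y) {P : V → ℝ} (hP : P ∈ stdSimplex ℝ V)
    {n k : ℕ} (hn : n ≠ 0) (hk : k ≠ 0) (cls : Fin n → L) (U : Set (V × V → ℝ))
    (f : L → X × Y → ℝ) (θ : ℝ) {t : ℝ} (ht : 0 ≤ t) {w : V × V → ℝ}
    (hw : w ∈ stdSimplex ℝ (V × V)) {η : ℝ} (hη : 0 < η) {δ : ℝ}
    (h1 : ∀ lam ∈ U, momentExponent S (classFreq cls) (diagFst lam) (fun l z => -t * f l z) +
      t * θ ≤ -δ)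
    (h2 : ∀ lam ∈ U, momentExponent S (classFreq cls) lam f - θ + (k : ℝ) / n *
      (∑ ab, lam ab * Real.log ((P ab.2 + η) / (w ab + η)) + η * Fintype.card (V × V)) ≤ -δ) :
    avgConfusionProb S P cls k U ≤ 2 * Real.exp (-δ) ^ n := by
  classical
  have hn0 : (n : ℝ) ≠ 0 := Nat.cast_ne_zero.2 hn
  set N : ℝ := ((Fintype.card (Network S cls k) : ℕ) : ℝ) with hN
  have hN0 : 0 ≤ N := Nat.cast_nonneg _
  refine div_le_of_le_mul₀ hN0 (by positivity) ?_
  refine (Finset.sum_le_sum fun s _ => confusionProb_le S hP s U f θ ht).trans ?_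
  rw [Finset.sum_add_distrib, two_mul, add_mul]
  refine add_le_add ?_ ?_
  · rw [Finset.sum_comm]
    simp_rw [← Finset.mul_sum]
    calc _ ≤ ∑ v : Fin k → V, priorProb P v * (Real.exp (-δ) ^ n * N) := by
          refine Finset.sum_le_sum fun v _ => mul_le_mul_of_nonneg_left ?_ (priorProb_nonneg hP v)
          split_ifs with h
          · obtain ⟨v', hv'⟩ := h
            have h := h1 _ hv'
            rw [diagFst_jointType] at h
            rw [one_mul]
            have hnet := sum_network_likelihood_mul_exp_le S hn hk cls v v fun l z => -t * f l z
            simp_rw [← Finset.mul_sum] at hnet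
            refine (mul_le_mul_of_nonneg_left hnet (Real.exp_pos _).le).trans ?_
            rw [← hN, mul_left_comm, mul_comm N, ← Real.exp_add, ← mul_add, Real.exp_nat_mul]
            refine mul_le_mul_of_nonneg_right ?_ hN0
            exact pow_le_pow_left₀ (Real.exp_pos _).le (Real.exp_le_exp.2 (by linarith)) n
          · rw [zero_mul]
            positivity
      _ = _ := by rw [← Finset.sum_mul, sum_priorProb hP, one_mul]
  · rw [Finset.sum_comm]
    simp_rw [Finset.sum_comm (s := (Finset.univ : Finset (Network S cls k))), ← Finset.mul_sum]
    refine sum_priorProb_le_exp hP hk hw hη _ (fun v v' => ?_) fun v v' => ?_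
    · split_ifs with h
      · have h := h2 _ h
        rw [one_mul]
        refine (mul_le_mul_of_nonneg_right (mul_le_mul_of_nonneg_left
          (sum_network_likelihood_mul_exp_le S hn hk cls v v' f) (Real.exp_pos _).le)
          (Real.exp_pos _).le).trans ?_
        rw [← hN, mul_left_comm, mul_assoc, mul_comm N, ← Real.exp_add, ← Real.exp_add]
        refine mul_le_mul_of_nonneg_right ?_ hN0
        rw [← Real.exp_nat_mul, Real.exp_le_exp]
        refine le_trans (le_of_eq ?_) (mul_le_mul_of_nonneg_left h (Nat.cast_nonneg n))
        field_simp
        ring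
      · rw [zero_mul, zero_mul]
        positivity
    · refine mul_nonneg (by split_ifs <;> norm_num) (mul_nonneg (Real.exp_pos _).le
        (Finset.sum_nonneg fun s _ => Finset.sum_nonneg fun y _ =>
          mul_nonneg (likelihood_nonneg S s v' y) (Real.exp_pos _).le))

theorem continuous_momentExponent (S : L → SensorClass V X Y) (g : L → X × Y → ℝ) :
    Continuous fun x : (L → ℝ) × (V × V → ℝ) => momentExponent S x.1 x.2 g := by
  unfold momentExponent
  refine continuous_finsetSum _ fun l _ => ?_
  have := (continuous_sum_distQ_mul (S l) fun z => Real.exp (g l z)).comp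
    (continuous_snd (X := L → ℝ) (Y := V × V → ℝ))
  exact Continuous.mul (by fun_prop) (this.sub continuous_const)

/-- Both exponents are jointly continuous in class frequencies, `k / n` and joint type. The
reference `lam` inside the logarithm stays frozen, so negativity at `lam` persists on a
neighbourhood for large `n`. -/
theorem exists_nhds_tendsto_of_exponents_neg (S : L → SensorClass V X Y) {P : V → ℝ}
    (hP : P ∈ stdSimplex ℝ V) {α : L → ℝ} {cls : (n : ℕ) → Fin n → L}
    (hcls : Tendsto (fun n => classFreq (cls n)) atTop (𝓝 α)) {k : ℕ → ℕ} {R : ℝ}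
    (hk : Tendsto k atTop atTop) (hkR : Tendsto (fun n => (k n : ℝ) / n) atTop (𝓝 R))
    {lam : V × V → ℝ} (hlam : lam ∈ stdSimplex ℝ (V × V))
    (f : L → X × Y → ℝ) (θ : ℝ) {t : ℝ} (ht : 0 ≤ t) {η : ℝ} (hη : 0 < η)
    (h1 : momentExponent S α (diagFst lam) (fun l z => -t * f l z) + t * θ < 0)
    (h2 : momentExponent S α lam f - θ + R * (∑ ab, lam ab *
      Real.log ((P ab.2 + η) / (lam ab + η)) + η * Fintype.card (V × V)) < 0) :
    ∃ U ∈ 𝓝 lam, Tendsto (fun n => avgConfusionProb S P (cls n) (k n) U) atTop (𝓝 0) := by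
  obtain ⟨c, hc, hc0⟩ := exists_between (max_lt h1 h2)
  obtain ⟨hc1, hc2⟩ := max_lt_iff.1 hc
  have hcont1 : Continuous fun x : ((L → ℝ) × ℝ) × (V × V → ℝ) =>
      momentExponent S x.1.1 (diagFst x.2) (fun l z => -t * f l z) + t * θ := by
    have := (continuous_momentExponent S fun l z => -t * f l z).comp
      ((continuous_fst.comp continuous_fst).prodMk (continuous_diagFst.comp continuous_snd) :
        Continuous fun x : ((L → ℝ) × ℝ) × (V × V → ℝ) => (x.1.1, diagFst x.2))
    exact this.add continuous_const
  have hcont2 : Continuous fun x : ((L → ℝ) × ℝ) × (V × V → ℝ) =>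
      momentExponent S x.1.1 x.2 f - θ + x.1.2 * (∑ ab, x.2 ab *
        Real.log ((P ab.2 + η) / (lam ab + η)) + η * Fintype.card (V × V)) := by
    have := (continuous_momentExponent S f).comp
      ((continuous_fst.comp continuous_fst).prodMk continuous_snd :
        Continuous fun x : ((L → ℝ) × ℝ) × (V × V → ℝ) => (x.1.1, x.2))
    exact (this.sub continuous_const).add (by fun_prop)
  have hev := (hcont1.continuousAt (x := ((α, R), lam)) |>.eventually_lt_const hc1).and
    (hcont2.continuousAt (x := ((α, R), lam)) |>.eventually_lt_const hc2)
  rw [nhds_prod_eq, eventually_prod_iff] at hev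
  obtain ⟨pa, hpa, pb, hpb, hab⟩ := hev
  refine ⟨{μ | pb μ}, hpb, ?_⟩
  have hlim : Tendsto (fun n : ℕ => 2 * Real.exp c ^ n) atTop (𝓝 0) := by
    simpa using (tendsto_pow_atTop_nhds_zero_of_lt_one (Real.exp_pos c).le
      (by simpa using hc0)).const_mul 2
  refine squeeze_zero' (Eventually.of_forall fun n => avgConfusionProb_nonneg S hP _ _ _) ?_ hlim
  filter_upwards [(hcls.prodMk_nhds hkR).eventually hpa, eventually_ne_atTop 0,
    hk.eventually_ne_atTop 0] with n hn hn0 hk0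
  rw [← neg_neg c]
  refine avgConfusionProb_le_exp S hP hn0 hk0 (cls n) _ f θ ht hlam hη ?_ ?_
  · intro μ hμ
    rw [neg_neg]
    exact (hab hn hμ).1.le
  · intro μ hμ
    rw [neg_neg]
    exact (hab hn hμ).2.le

end Feasible

/-! ### Choice of the test, compactness and extraction of a network -/

section Achievability

variable {V X Y L : Type*} [Fintype V] [DecidableEq V] [Fintype X] [DecidableEq X] [Fintype Y]
  [Fintype L] [DecidableEq L]

theorem diagFst_mem_stdSimplex {lam : V × V → ℝ} (h : lam ∈ stdSimplex ℝ (V × V)) :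
    diagFst lam ∈ stdSimplex ℝ (V × V) := by
  refine ⟨fun ab => ?_, ?_⟩
  · unfold diagFst
    split_ifs
    · exact Finset.sum_nonneg fun b _ => h.1 _
    · exact le_rfl
  · rw [Fintype.sum_prod_type]
    simp only [diagFst, Finset.sum_ite_eq, Finset.mem_univ, if_true]
    rw [← Fintype.sum_prod_type, h.2]

theorem distP_mem_stdSimplex (C : SensorClass V X Y) {P : V → ℝ} {lam : V × V → ℝ}
    (hlam : lam ∈ stdSimplex ℝ (V × V)) (h : ∀ a, ∑ b, lam (a, b) = P a) :
    distP C P ∈ stdSimplex ℝ (X × Y) := by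
  have hd := diagFst_mem_stdSimplex hlam
  rw [← distQ_diagFst C h]
  exact ⟨distQ_nonneg C hd.1, sum_distQ C hd⟩

theorem exists_nhds_tendsto_of_mem_feasible {S : L → SensorClass V X Y} {P : V → ℝ}
    (hP : P ∈ stdSimplex ℝ V) {α : L → ℝ≥0} {cls : (n : ℕ) → Fin n → L}
    (hcls : HasFrequencies cls α) {k : ℕ → ℕ} {R : ℝ≥0} (hR0 : 0 < R) {D : ℝ}
    (hR : (R : ℝ≥0∞) < lowerBound S α P D)
    (hk : Tendsto k atTop atTop) (hkR : Tendsto (fun n => (k n : ℝ) / n) atTop (𝓝 (R : ℝ)))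
    {lam : V × V → ℝ} (hlam : lam ∈ feasible P D) :
    ∃ U ∈ 𝓝 lam, Tendsto (fun n => avgConfusionProb S P (cls n) (k n) U) atTop (𝓝 0) := by
  have hdist : ∀ l, distP (S l) P ∈ stdSimplex ℝ (X × Y) :=
    fun l => distP_mem_stdSimplex (S l) hlam.1 hlam.2.1
  have hq : ∀ l z, 0 ≤ distQ (S l) lam z := fun l => distQ_nonneg (S l) hlam.1.1
  obtain ⟨η, hη, hlt⟩ := exists_regDiv_gt (p := fun l => distP (S l) P)
    (q := fun l => distQ (S l) lam) (fun l => (hdist l).1) hq (r := lam)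
    (w := fun ab => P ab.2) hlam.1.1 (fun ab => hP.1 _) α (R := R) hR0
    -- The total cost of regularization per unit `η`: the first summand pays for the moments of `exp
    -- f` in `hm`, the second for the product weight on pairs.
    ((∑ l, (α l : ℝ)) * Fintype.card (X × Y) + R * Fintype.card (V × V))
    (sum_divergence_pos_of_lt_lowerBound hP hR0 hR hlam hdist)
  -- The threshold lies below the mean of the statistic under the true vector, so its lower tail
  -- decays, and above the exponent of the competing pairs plus the `η` cost.
  obtain ⟨θ, hθ1, hθ2⟩ := exists_between (sub_lt_iff_lt_add.2 hlt)
  set f : L → X × Y → ℝ :=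
    fun l z => Real.log ((distP (S l) P z + η) / (distQ (S l) lam z + η)) with hf
  have hA : ∑ l, (α l : ℝ) * regDiv (distP (S l) P) (distQ (S l) lam) η =
      ∑ l, (α l : ℝ) * ∑ z, distP (S l) P z * f l z := rfl
  obtain ⟨t, ht0, ht⟩ : ∃ t > 0, momentExponent S (fun l => (α l : ℝ)) (diagFst lam)
      (fun l z => -t * f l z) + t * θ < 0 := by
    refine exists_pos_neg_of_hasDerivAt
      (d := ∑ l, (α l : ℝ) * ∑ z, distP (S l) P z * -f l z + θ) ?_ ?_ ?_
    · unfold momentExponent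
      refine HasDerivAt.add (HasDerivAt.fun_sum fun l _ => HasDerivAt.const_mul _
        (HasDerivAt.sub_const _ (HasDerivAt.fun_sum fun z _ => ?_))) ?_
      · rw [distQ_diagFst (S l) hlam.2.1]
        refine HasDerivAt.const_mul _ ?_
        simpa using ((hasDerivAt_id (0 : ℝ)).neg.mul_const (f l z)).exp
      · simpa using (hasDerivAt_id (0 : ℝ)).mul_const θ
    · simp [momentExponent, distQ_diagFst _ hlam.2.1, (hdist _).2]
    · simp_rw [mul_neg, Finset.sum_neg_distrib, mul_neg, Finset.sum_neg_distrib, ← hA]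
      linarith
  refine exists_nhds_tendsto_of_exponents_neg S hP (α := fun l => (α l : ℝ))
    (tendsto_pi_nhds.2 hcls) hk hkR hlam.1 f θ ht0.le hη ht ?_
  have hm : momentExponent S (fun l => (α l : ℝ)) lam f ≤
      (∑ l, (α l : ℝ)) * Fintype.card (X × Y) * η := by
    rw [momentExponent, mul_assoc, Finset.sum_mul]
    refine Finset.sum_le_sum fun l _ => mul_le_mul_of_nonneg_left ?_ (NNReal.coe_nonneg _)
    -- Here `exp f = (p + η) / (q + η)` and `q ≤ q + η`, so the moment under `q` exceeds `1` by at
    -- most `η` per outcome.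
    have : ∀ z, distQ (S l) lam z * Real.exp (f l z) ≤ distP (S l) P z + η := by
      intro z
      have h1 : 0 < distQ (S l) lam z + η := add_pos_of_nonneg_of_pos (hq l z) hη
      have h2 : 0 < distP (S l) P z + η := add_pos_of_nonneg_of_pos ((hdist l).1 z) hη
      rw [hf, Real.exp_log (div_pos h2 h1), mul_div_assoc', div_le_iff₀ h1, mul_comm]
      exact mul_le_mul_of_nonneg_left (by linarith) h2.le
    have := Finset.sum_le_sum fun z (_ : z ∈ Finset.univ) => this z
    rw [Finset.sum_add_distrib, (hdist l).2, Finset.sum_const, nsmul_eq_mul,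
      Finset.card_univ] at this
    linarith
  have hr : ∑ ab : V × V, lam ab * Real.log ((P ab.2 + η) / (lam ab + η)) =
      -regDiv lam (fun ab => P ab.2) η := by
    rw [regDiv, ← Finset.sum_neg_distrib]
    refine Finset.sum_congr rfl fun ab _ => ?_
    rw [← inv_div, Real.log_inv, mul_neg]
  rw [hr]
  linarith

/-- The distributions on `V × V` with off-diagonal mass at least `D`. -/
def offDiagSet (V : Type*) [Fintype V] [DecidableEq V] (D : ℝ) : Set (V × V → ℝ) :=
  stdSimplex ℝ (V × V) ∩ {lam | D ≤ ∑ a, ∑ b, if a ≠ b then lam (a, b) else 0}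

theorem isCompact_offDiagSet (D : ℝ) : IsCompact (offDiagSet V D) := by
  refine (isCompact_stdSimplex ℝ (V × V)).inter_right (isClosed_le continuous_const ?_)
  refine continuous_finsetSum _ fun a _ => continuous_finsetSum _ fun b _ => ?_
  split_ifs <;> fun_prop

theorem jointType_mem_offDiagSet {k : ℕ} (hk : k ≠ 0) {v v' : Fin k → V} {D : ℝ}
    (h : D ≤ (hammingDist v v' : ℝ) / k) : jointType v v' ∈ offDiagSet V D := by
  refine ⟨jointType_mem_stdSimplex hk v v', h.trans (le_of_eq ?_)⟩
  have := sum_jointType_mul v v' fun ab => if ab.1 ≠ ab.2 then 1 else 0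
  rw [Fintype.sum_prod_type] at this
  simp only [mul_ite, mul_one, mul_zero] at this
  rw [this, hammingDist, Finset.sum_boole]

/-- Being asymptotically negligible is monotone and stable under finite unions, so compactness
reduces it to a neighbourhood of each point. -/
theorem tendsto_avgConfusionProb {S : L → SensorClass V X Y} {P : V → ℝ}
    (hP : P ∈ stdSimplex ℝ V) {α : L → ℝ≥0} {cls : (n : ℕ) → Fin n → L}
    (hcls : HasFrequencies cls α) {k : ℕ → ℕ} {R : ℝ≥0} (hR0 : 0 < R) {D : ℝ}
    (hR : (R : ℝ≥0∞) < lowerBound S α P D)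
    (hk : Tendsto k atTop atTop) (hkR : Tendsto (fun n => (k n : ℝ) / n) atTop (𝓝 (R : ℝ))) :
    Tendsto (fun n => avgConfusionProb S P (cls n) (k n) (offDiagSet V D)) atTop (𝓝 0) := by
  refine IsCompact.induction_on (isCompact_offDiagSet D)
    (p := fun U => Tendsto (fun n => avgConfusionProb S P (cls n) (k n) U) atTop (𝓝 0))
    ?_ ?_ ?_ ?_
  · simp [avgConfusionProb_empty]
  · exact fun U U' hU h => squeeze_zero (fun n => avgConfusionProb_nonneg S hP _ _ _)
      (fun n => avgConfusionProb_mono S hP _ _ hU) h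
  · intro U U' h h'
    refine squeeze_zero (fun n => avgConfusionProb_nonneg S hP _ _ _)
      (fun n => avgConfusionProb_union_le S hP _ _ U U') ?_
    simpa using h.add h'
  · intro lam hlam
    by_cases hm : ∀ a, ∑ b, lam (a, b) = P a
    · obtain ⟨U, hU, h⟩ := exists_nhds_tendsto_of_mem_feasible hP hcls hR0 hR hk hkR
        (lam := lam) ⟨hlam.1, hm, hlam.2⟩
      exact ⟨U, mem_nhdsWithin_of_mem_nhds hU, h⟩
    · obtain ⟨U, hU, h⟩ := exists_nhds_tendsto_of_fst_marginal_ne S hP cls hk (not_forall.1 hm)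
      exact ⟨U, mem_nhdsWithin_of_mem_nhds hU, h⟩

theorem errorProb_nonneg (S : L → SensorClass V X Y) {P : V → ℝ} (hP : P ∈ stdSimplex ℝ V) (D : ℝ)
    {n k : ℕ} {cls : Fin n → L} (s : Network S cls k) (g : (Fin n → Y) → (Fin k → V)) :
    0 ≤ errorProb S P D s g :=
  Finset.sum_nonneg fun v _ => mul_nonneg (priorProb_nonneg hP v) <| Finset.sum_nonneg fun y _ =>
    mul_nonneg (likelihood_nonneg S s v y) (by split_ifs <;> norm_num)

/-- The detected vector is itself a competitor witnessing confusion. The non-strict comparison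
covers every way of breaking ties. -/
theorem errorProb_le_confusionProb (S : L → SensorClass V X Y) {P : V → ℝ}
    (hP : P ∈ stdSimplex ℝ V) {D : ℝ} {n k : ℕ} (hk : k ≠ 0) {cls : Fin n → L}
    (s : Network S cls k) {g : (Fin n → Y) → (Fin k → V)} (hg : IsMAP S P s g) :
    errorProb S P D s g ≤ confusionProb S P s (offDiagSet V D) := by
  unfold errorProb confusionProb
  simp_rw [Finset.mul_sum, ← mul_assoc]
  refine Finset.sum_le_sum fun v _ => Finset.sum_le_sum fun y _ =>
    mul_le_mul_of_nonneg_left ?_ (joint_nonneg S hP s v y)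
  by_cases h : (hammingDist v (g y) : ℝ) / k < D
  · rw [if_pos h]
    split_ifs <;> norm_num
  · rw [if_neg h, if_pos ⟨g y, jointType_mem_offDiagSet hk (not_lt.1 h), hg y v⟩]

theorem achievable_of_lt_lowerBound {S : L → SensorClass V X Y} {P : V → ℝ}
    (hP : P ∈ stdSimplex ℝ V) {α : L → ℝ≥0} {cls : (n : ℕ) → Fin n → L}
    (hcls : HasFrequencies cls α) {R : ℝ≥0} (hR0 : 0 < R) {D : ℝ}
    (hR : (R : ℝ≥0∞) < lowerBound S α P D) : Achievable S P D cls R := by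
  have hR0' : (0 : ℝ) < R := hR0
  have hkR : Tendsto (fun n : ℕ => (⌈(n : ℝ) * R⌉₊ : ℝ) / n) atTop (𝓝 (R : ℝ)) := by
    have := (tendsto_nat_ceil_mul_div_atTop hR0'.le).comp (tendsto_natCast_atTop_atTop (R := ℝ))
    simpa only [Function.comp_def, mul_comm] using this
  have hk : Tendsto (fun n : ℕ => ⌈(n : ℝ) * R⌉₊) atTop atTop :=
    tendsto_nat_ceil_atTop.comp (tendsto_natCast_atTop_atTop.atTop_mul_const hR0')
  have hlim := tendsto_avgConfusionProb hP hcls hR0 hR hk hkR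
  have hne : ∀ n : ℕ, Nonempty (Network S (cls n) ⌈(n : ℝ) * R⌉₊) := by
    intro n
    -- A sensor `ℓ` exists only if `n > 0`, and then there is at least one position; for `n = 0` the
    -- network is empty.
    refine ⟨fun ℓ _ => ⟨0, Nat.ceil_pos.2 (mul_pos ?_ hR0')⟩⟩
    exact_mod_cast ℓ.pos
  have hmin : ∀ n : ℕ, ∃ s : Network S (cls n) ⌈(n : ℝ) * R⌉₊,
      confusionProb S P s (offDiagSet V D) ≤
        avgConfusionProb S P (cls n) ⌈(n : ℝ) * R⌉₊ (offDiagSet V D) := by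
    intro n
    have := hne n
    obtain ⟨s, -, hs⟩ := Finset.exists_le_of_sum_le (s := Finset.univ) Finset.univ_nonempty
      (f := fun s : Network S (cls n) ⌈(n : ℝ) * R⌉₊ => confusionProb S P s (offDiagSet V D))
      (g := fun _ => avgConfusionProb S P (cls n) ⌈(n : ℝ) * R⌉₊ (offDiagSet V D)) (by
        rw [Finset.sum_const, nsmul_eq_mul, Finset.card_univ, avgConfusionProb,
          mul_div_cancel₀ _ (Nat.cast_ne_zero.2 Fintype.card_ne_zero)])
    exact ⟨s, hs⟩
  -- The network is fixed before any detector, which is legitimate because the confusion probability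
  -- involves none.
  choose s hs using hmin
  refine ⟨s, fun g hg => squeeze_zero' (Eventually.of_forall fun n => errorProb_nonneg S hP D _ _)
    ?_ hlim⟩
  filter_upwards [hk.eventually_ne_atTop 0] with n hn
  exact (errorProb_le_confusionProb S hP hn (s n) (hg n)).trans (hs n)

end Achievability


end SensorNetwork

theorem mainTheorem7 {V X Y L : Type*}
    [Fintype V] [DecidableEq V] [Fintype X] [DecidableEq X] [Fintype Y]
    [Fintype L] [DecidableEq L]
    (S : L → SensorNetwork.SensorClass V X Y)
    (α : L → ℝ≥0)
    (cls : (n : ℕ) → Fin n → L) (hcls : SensorNetwork.HasFrequencies cls α)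
    (P : V → ℝ) (hP : P ∈ stdSimplex ℝ V)
    (D : ℝ) (hD : D ∈ Set.Icc (0 : ℝ) 1) :
    SensorNetwork.lowerBound S α P D ≤ SensorNetwork.sensingCapacity S P D cls := by
  refine le_of_forall_lt_imp_le_of_dense fun c hc => ?_
  lift c to ℝ≥0 using hc.ne_top
  refine le_iSup₂_of_le c (fun R' h0 hR' => ?_) le_rfl
  exact SensorNetwork.achievable_of_lt_lowerBound hP hcls h0
    ((ENNReal.coe_lt_coe.2 hR').trans hc)
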